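/- Identify $n\in\omega$ with $\{0,\dots,n-1\}$ and, for $S\subseteq\omega\times\omega$, write $S(n)=\{m : (n,m)\in S\}$. Let $\mathcal S=\{S\subseteq\omega\times\omega : |S(n)|<2^n \text{ for every } n\}$, let $\mathcal I=\{S\subseteq\omega\times\omega : S(n)\subseteq 2^n \text{ for every } n \text{ and } \sum_n |S(n)|/2^n<\infty\}$, and let $\mathcal W=\mathcal I\cap\mathcal S$. Let $\Omega=\{(S,n) : n\in\omega,\ S\in\mathcal S,\ S\subseteq n\times 2^n\}$ (a countably infinite set). For $A\subseteq\omega\times\omega$ put $T_A=\{(T,n)\in\Omega : A\cap(n\times 2^n)\subseteq T\}$, and for $(S,n)\in\Omega$ put $T_{(S,n)}=\{(T,m)\in\Omega : m\ge n,\ T\cap(n\times 2^n)=S\}$. Let $\mathfrak T_{\mathcal W}$ be the Boolean subalgebra of $\mathcal P(\Omega)$ generated by $\{T_W : W\in\mathcal W\}\cup\{T_{(S,n)} : (S,n)\in\Omega\}$, let $\mathfrak T_{\mathcal W}/\mathrm{Fin}$ be its image in $\mathcal P(\Omega)/\mathrm{Fin}$ (subsets of $\Omega$ modulo finite sets), and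 let $K$ be the Stone space of $\mathfrak T_{\mathcal W}/\mathrm{Fin}$. **Theorem (ZFC).** The space $K$ has the following properties: 1. $K$ is a growth of $\omega$, i.e. there is a compact Hausdorff space $L$ containing the discrete space $\omega$ as a dense subspace such that $K$ is homeomorphic to $L\setminus\omega$; 2. $K$ is not separable; 3. $K$ supports a measure, i.e. there is a regular Borel probability measure on $K$ that is positive on every nonempty open subset of $K$; 4. $K$ can be mapped continuously onto $[0,1]^{\mathfrak c}$, where $\mathfrak c=2^{\aleph_0}$. In particular, there is a non-separable growth of $\omega$ that supports a measure and can be mapped continuously onto $[0,1]^{\mathfrak c}$. -/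

import Mathlib

open Set Topology MeasureTheory Cardinal

namespace SlalomGrowth

/-! ### Compactifications and growths of `ω`, measures on compact spaces -/

/-- `e` exhibits `L` as a (Hausdorff) compactification of the discrete space `ℕ`. -/
structure IsCompactificationOfOmega {L : Type*} [TopologicalSpace L] (e : ℕ → L) : Prop where
  compact : CompactSpace L
  hausdorff : T2Space L
  embedding : IsEmbedding e
  dense : DenseRange e

/-- `K` is (up to homeomorphism) a growth `L \ ω` of `ω`, for some compactification `L` of `ω`. -/
def IsGrowthOfOmega (K : Type) [TopologicalSpace K] : Prop :=
  ∃ (L : Type) (_ : TopologicalSpace L) (e : ℕ → L),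
    IsCompactificationOfOmega e ∧ Nonempty (K ≃ₜ ((range e)ᶜ : Set L))

/-- `K` supports a measure: there is a regular Borel probability measure on `K` which is positive
on each nonempty open set. -/
def SupportsMeasure (K : Type*) [TopologicalSpace K] : Prop :=
  ∃ μ : @Measure K (borel K), @IsProbabilityMeasure K (borel K) μ ∧
    @Measure.Regular K (borel K) _ μ ∧ @Measure.IsOpenPosMeasure K _ (borel K) μ

/-! ### The Stone space of a Boolean algebra -/

/-- The Stone space of a Boolean algebra: its points are the ultrafilters of the algebra. -/
@[ext]
structure StoneSpace (A : Type*) [BooleanAlgebra A] where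
  carrier : Set A
  top_mem : ⊤ ∈ carrier
  bot_notMem : ⊥ ∉ carrier
  inf_mem : ∀ a ∈ carrier, ∀ b ∈ carrier, a ⊓ b ∈ carrier
  mem_of_le : ∀ a ∈ carrier, ∀ b, a ≤ b → b ∈ carrier
  mem_or_compl_mem : ∀ a, a ∈ carrier ∨ aᶜ ∈ carrier

/-- The topology generated by the sets of all ultrafilters containing a given element. -/
instance StoneSpace.instTopologicalSpace (A : Type*) [BooleanAlgebra A] :
    TopologicalSpace (StoneSpace A) :=
  TopologicalSpace.generateFrom {V | ∃ a : A, V = {u : StoneSpace A | a ∈ u.carrier}}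

/-! ### The Boolean algebra `P(X)/Fin` -/

/-- Two subsets of `X` are equivalent when their symmetric difference is finite. -/
def finSetoid (X : Type*) : Setoid (Set X) where
  r A B := (symmDiff A B).Finite
  iseqv :=
    { refl := fun A => by simp
      symm := fun {A B} h => by rwa [symmDiff_comm]
      trans := fun {A B C} h₁ h₂ => (h₁.union h₂).subset (symmDiff_triangle A B C) }

/-- The quotient `P(X)/Fin`. -/
def PModFin (X : Type*) : Type _ := Quotient (finSetoid X)

namespace PModFin

variable {X : Type*}

/-- The class of a set in `P(X)/Fin`. -/
def mk (A : Set X) : PModFin X := Quotient.mk (finSetoid X) A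

lemma mk_eq_mk {A B : Set X} : mk A = mk B ↔ (symmDiff A B).Finite :=
  Quotient.eq (r := finSetoid X)

instance : Max (PModFin X) :=
  ⟨Quotient.map₂ (· ∪ ·) fun A A' h B B' h' => (h.union h').subset (by
    intro x; simp only [mem_symmDiff, mem_union]; tauto)⟩

instance : Min (PModFin X) :=
  ⟨Quotient.map₂ (· ∩ ·) fun A A' h B B' h' => (h.union h').subset (by
    intro x; simp only [mem_symmDiff, mem_union, mem_inter_iff]; tauto)⟩

instance : Compl (PModFin X) :=
  ⟨Quotient.map compl fun A A' (h : (symmDiff A A').Finite) => h.subset (by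
    intro x; simp only [mem_symmDiff, mem_compl_iff]; tauto)⟩

instance : Top (PModFin X) := ⟨mk univ⟩

instance : Bot (PModFin X) := ⟨mk ∅⟩

lemma mk_sup (A B : Set X) : mk A ⊔ mk B = mk (A ∪ B) := rfl

lemma mk_inf (A B : Set X) : mk A ⊓ mk B = mk (A ∩ B) := rfl

lemma compl_mk (A : Set X) : (mk A)ᶜ = mk Aᶜ := rfl

lemma ind {p : PModFin X → Prop} (h : ∀ A, p (mk A)) (a : PModFin X) : p a := Quotient.ind h a

instance : LE (PModFin X) :=
  ⟨Quotient.lift₂ (fun A B => (A \ B).Finite) fun A B A' B' (h : (symmDiff A A').Finite)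
      (h' : (symmDiff B B').Finite) => propext
    ⟨fun k => ((h.union h').union k).subset (by
        intro x; simp only [mem_symmDiff, mem_union, Set.mem_sdiff]; tauto),
      fun k => ((h.union h').union k).subset (by
        intro x; simp only [mem_symmDiff, mem_union, Set.mem_sdiff]; tauto)⟩⟩

lemma mk_le_mk {A B : Set X} : mk A ≤ mk B ↔ (A \ B).Finite := Iff.rfl

lemma mk_le_mk_of_subset {A B : Set X} (h : A ⊆ B) : mk A ≤ mk B := by
  rw [mk_le_mk, sdiff_eq_empty.2 h]; exact finite_empty

/-- `P(X)/Fin` with the operations induced by those of `P(X)`, ordered by inclusion modulo finite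
sets. -/
instance : BooleanAlgebra (PModFin X) where
  le_refl a := by
    induction a using ind with | _ A => exact mk_le_mk_of_subset subset_rfl
  le_trans a b c := by
    induction a using ind with | _ A =>
    induction b using ind with | _ B =>
    induction c using ind with | _ C =>
    intro h k
    exact ((mk_le_mk.1 h).union (mk_le_mk.1 k)).subset (by
      intro x; simp only [mem_union, Set.mem_sdiff]; tauto)
  le_antisymm a b := by
    induction a using ind with | _ A =>
    induction b using ind with | _ B =>
    intro h k
    exact mk_eq_mk.2 ((mk_le_mk.1 h).union (mk_le_mk.1 k))
  sup := max
  inf := min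
  le_sup_left a b := by
    induction a using ind with | _ A =>
    induction b using ind with | _ B => exact mk_le_mk_of_subset subset_union_left
  le_sup_right a b := by
    induction a using ind with | _ A =>
    induction b using ind with | _ B => exact mk_le_mk_of_subset subset_union_right
  sup_le a b c := by
    induction a using ind with | _ A =>
    induction b using ind with | _ B =>
    induction c using ind with | _ C =>
    intro h k
    exact mk_le_mk.2 (((mk_le_mk.1 h).union (mk_le_mk.1 k)).subset (by
      intro x; simp only [mem_union, Set.mem_sdiff]; tauto))
  inf_le_left a b := by
    induction a using ind with | _ A =>
    induction b using ind with | _ B => exact mk_le_mk_of_subset inter_subset_left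
  inf_le_right a b := by
    induction a using ind with | _ A =>
    induction b using ind with | _ B => exact mk_le_mk_of_subset inter_subset_right
  le_inf a b c := by
    induction a using ind with | _ A =>
    induction b using ind with | _ B =>
    induction c using ind with | _ C =>
    intro h k
    exact mk_le_mk.2 (((mk_le_mk.1 h).union (mk_le_mk.1 k)).subset (by
      intro x; simp only [mem_union, Set.mem_sdiff, mem_inter_iff]; tauto))
  le_sup_inf a b c := by
    induction a using ind with | _ A =>
    induction b using ind with | _ B =>
    induction c using ind with | _ C =>
    exact mk_le_mk_of_subset (union_inter_distrib_left A B C).ge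
  inf_compl_le_bot a := by
    induction a using ind with | _ A => exact mk_le_mk_of_subset (inter_compl_self A).le
  top_le_sup_compl a := by
    induction a using ind with | _ A => exact mk_le_mk_of_subset (union_compl_self A).ge
  le_top a := by
    induction a using ind with | _ A => exact mk_le_mk_of_subset (subset_univ A)
  bot_le a := by
    induction a using ind with | _ A => exact mk_le_mk_of_subset (empty_subset A)

/-- The quotient homomorphism `P(X) → P(X)/Fin`. -/
def mkHom (X : Type*) : BoundedLatticeHom (Set X) (PModFin X) where
  toFun := mk
  map_sup' _ _ := rfl
  map_inf' _ _ := rfl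
  map_top' := rfl
  map_bot' := rfl

end PModFin

/-! ### Slaloms and the algebras built from them -/

/-- The section `S(n) = {m : (n, m) ∈ S}`. -/
def sec (S : Set (ℕ × ℕ)) (n : ℕ) : Set ℕ := {m | (n, m) ∈ S}

/-- The family `𝒮` of slaloms: `|S(n)| < 2 ^ n` for each `n`. -/
def slaloms : Set (Set (ℕ × ℕ)) := {S | ∀ n, (sec S n).encard < ((2 ^ n : ℕ) : ℕ∞)}

/-- The rectangle `n × 2 ^ n`. -/
def box (n : ℕ) : Set (ℕ × ℕ) := Iio n ×ˢ Iio (2 ^ n)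

/-- The countable set `Ω` of pairs `(S, n)` with `S` a slalom contained in `n × 2 ^ n`. -/
def Omega : Type := {p : Set (ℕ × ℕ) × ℕ // p.1 ∈ slaloms ∧ p.1 ⊆ box p.2}

/-- `T_A = {(T, n) ∈ Ω : A ∩ (n × 2 ^ n) ⊆ T}`. -/
def TSet (A : Set (ℕ × ℕ)) : Set Omega := {p | A ∩ box p.1.2 ⊆ p.1.1}

/-- `T_(S,n) = {(T, m) ∈ Ω : m ≥ n, T ∩ (n × 2 ^ n) = S}`. -/
def TNode (q : Omega) : Set Omega := {p | q.1.2 ≤ p.1.2 ∧ p.1.1 ∩ box q.1.2 = q.1.1}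

/-- The subalgebra `𝔗_𝒜` of `P(Ω)` generated by all `T_A`, `A ∈ 𝒜`, and all `T_(S,n)`. -/
def slalomAlgebra (𝒜 : Set (Set (ℕ × ℕ))) : BooleanSubalgebra (Set Omega) :=
  sInf {B | TSet '' 𝒜 ∪ range TNode ⊆ (B : Set (Set Omega))}

/-- The subalgebra `𝔗_𝒜/Fin` of `P(Ω)/Fin`. -/
def slalomAlgebraModFin (𝒜 : Set (Set (ℕ × ℕ))) : BooleanSubalgebra (PModFin Omega) :=
  (slalomAlgebra 𝒜).map (PModFin.mkHom Omega)

/-- The space `K_𝒜`, the Stone space of `𝔗_𝒜/Fin`. -/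
abbrev KSpace (𝒜 : Set (Set (ℕ × ℕ))) : Type := StoneSpace (slalomAlgebraModFin 𝒜)

/-- The family `ℐ`: `S(n) ⊆ 2 ^ n` for each `n`, and `∑ₙ |S(n)| / 2 ^ n < ∞`. -/
def summableFamily : Set (Set (ℕ × ℕ)) :=
  {S | (∀ n, sec S n ⊆ Iio (2 ^ n)) ∧ Summable fun n => ((sec S n).ncard : ℝ) / 2 ^ n}

/-- The family `𝒲 = ℐ ∩ 𝒮`. -/
def familyW : Set (Set (ℕ × ℕ)) := summableFamily ∩ slaloms

end SlalomGrowth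

/-! Each slalom `S` gives a branch of the tree `Ω`, namely the nodes `(S ∩ box n, n)`. By induction
on the algebra, every element eventually contains or eventually omits the nodes of the branch
(`eventually_node_mem_or`). So `S` defines a point of `K`, and that point contains the class of
`T_W` exactly when `W ⊆ S` (`genClass_mem_branch`). These points carry the proof.

Growth: the algebra contains all singletons of the countable set `Ω`, so its Stone space
compactifies `Ω`, and the ultrafilters containing no finite set form the remainder.

Non-separability: a node of height above `n` cannot contain the whole column `2 ^ n`. So each point
of `K` omits the class of `T_{(n,m)}` for some `m < 2 ^ n` (`exists_genClass_singleton_notMem`).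
Given a sequence of points, a diagonal choice of one such `m` per column is a graph `W ∈ 𝒲` whose
nonempty clopen set misses the whole sequence.

Measure: pick a node at random and extend it by full columns, each lacking one random point. The
omitted point of column `k` is uniform on `2 ^ k`, so summability of `|W(k)| / 2 ^ k` and the union
bound show that finitely many `W` are avoided in all late columns with positive probability.
Together with `exists_finite_determination`, this makes every nonzero element of the algebra have
positive probability; the Riesz theorem turns the law of the random point into a regular Borel
measure.

Cube: the graphs of dyadic approximations of distinct reals are eventually disjoint, and together
they fill at most half of each column. They therefore yield an independent family of size continuum,
hence a map onto a Cantor cube, and binary expansion finishes. -/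

namespace SlalomGrowth

/-! ### Stone spaces -/

namespace StoneSpace

variable {A : Type*} [BooleanAlgebra A]

/-- The basic clopen set of all ultrafilters containing `a`. -/
def basicClopen (a : A) : Set (StoneSpace A) := {u | a ∈ u.carrier}

lemma mem_basicClopen {a : A} {u : StoneSpace A} : u ∈ basicClopen a ↔ a ∈ u.carrier := Iff.rfl

lemma inf_mem_iff (u : StoneSpace A) {a b : A} :
    a ⊓ b ∈ u.carrier ↔ a ∈ u.carrier ∧ b ∈ u.carrier :=
  ⟨fun h => ⟨u.mem_of_le _ h _ inf_le_left, u.mem_of_le _ h _ inf_le_right⟩,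
    fun h => u.inf_mem _ h.1 _ h.2⟩

lemma compl_mem_iff (u : StoneSpace A) {a : A} : aᶜ ∈ u.carrier ↔ a ∉ u.carrier :=
  ⟨fun h k => u.bot_notMem (by simpa using u.inf_mem _ k _ h),
    fun h => (u.mem_or_compl_mem a).resolve_left h⟩

lemma sup_mem_iff (u : StoneSpace A) {a b : A} :
    a ⊔ b ∈ u.carrier ↔ a ∈ u.carrier ∨ b ∈ u.carrier := by
  rw [← not_iff_not, ← compl_mem_iff, compl_sup, inf_mem_iff, compl_mem_iff, compl_mem_iff, not_or]

lemma isOpen_basicClopen (a : A) : IsOpen (basicClopen a) :=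
  TopologicalSpace.isOpen_generateFrom_of_mem ⟨a, rfl⟩

lemma compl_basicClopen (a : A) : (basicClopen a)ᶜ = basicClopen aᶜ := by
  ext u; simp [mem_basicClopen, compl_mem_iff]

lemma isClopen_basicClopen (a : A) : IsClopen (basicClopen a) :=
  ⟨⟨by rw [compl_basicClopen]; exact isOpen_basicClopen _⟩, isOpen_basicClopen a⟩

lemma isTopologicalBasis_basicClopen :
    TopologicalSpace.IsTopologicalBasis {V | ∃ a : A, V = basicClopen a} where
  exists_subset_inter := by
    rintro _ ⟨a, rfl⟩ _ ⟨b, rfl⟩ u ⟨ha, hb⟩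
    exact ⟨_, ⟨a ⊓ b, rfl⟩, u.inf_mem _ ha _ hb, fun v hv => (inf_mem_iff v).1 hv⟩
  sUnion_eq := eq_univ_of_forall fun u => ⟨_, ⟨⊤, rfl⟩, u.top_mem⟩
  eq_generateFrom := rfl

lemma exists_basicClopen_subset {U : Set (StoneSpace A)} (hU : IsOpen U) {u : StoneSpace A}
    (hu : u ∈ U) : ∃ a ∈ u.carrier, basicClopen a ⊆ U := by
  obtain ⟨_, ⟨a, rfl⟩, ha, h⟩ := isTopologicalBasis_basicClopen.exists_subset_of_mem_open hu hU
  exact ⟨a, ha, h⟩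

instance : T2Space (StoneSpace A) where
  t2 u v huv := by
    obtain ⟨a, h⟩ : ∃ a, ¬ (a ∈ u.carrier ↔ a ∈ v.carrier) := by
      by_contra! h
      exact huv (StoneSpace.ext (Set.ext h))
    have hd : Disjoint (basicClopen a) (basicClopen aᶜ) := by
      rw [← compl_basicClopen]; exact disjoint_compl_right
    by_cases ha : a ∈ u.carrier
    · exact ⟨_, _, isOpen_basicClopen a, isOpen_basicClopen aᶜ, ha,
        (compl_mem_iff v).2 fun k => h (iff_of_true ha k), hd⟩
    · refine ⟨_, _, isOpen_basicClopen aᶜ, isOpen_basicClopen a, (compl_mem_iff u).2 ha, ?_,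
        hd.symm⟩
      by_contra k
      exact h (iff_of_false ha k)

/-- The limit of an ultrafilter on the Stone space. -/
def ultrafilterLim (F : Ultrafilter (StoneSpace A)) : StoneSpace A where
  carrier := {a | basicClopen a ∈ F}
  top_mem := by
    have : basicClopen (⊤ : A) = Set.univ := eq_univ_of_forall fun u => u.top_mem
    rw [mem_ofPred_eq, this]
    exact Filter.univ_mem
  bot_notMem := by
    have : basicClopen (⊥ : A) = ∅ := eq_empty_of_forall_notMem fun u => u.bot_notMem
    simp [this]
  inf_mem a ha b hb := Filter.mem_of_superset (Filter.inter_mem ha hb)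
    fun u hu => u.inf_mem _ hu.1 _ hu.2
  mem_of_le a ha b hab := Filter.mem_of_superset ha fun u hu => u.mem_of_le _ hu _ hab
  mem_or_compl_mem a := by
    simp only [mem_ofPred_eq, ← compl_basicClopen]
    exact F.mem_or_compl_mem _

instance : CompactSpace (StoneSpace A) where
  isCompact_univ := isCompact_iff_ultrafilter_le_nhds.2 fun F _ => ⟨ultrafilterLim F, trivial,
    fun U hU => by
      obtain ⟨V, hVU, hV, hF⟩ := mem_nhds_iff.1 hU
      obtain ⟨a, ha, h⟩ := exists_basicClopen_subset hV hF
      exact Filter.mem_of_superset (show basicClopen a ∈ F from ha) (h.trans hVU)⟩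

lemma exists_basicClopen_between {Z U : Set (StoneSpace A)} (hZ : IsClosed Z) (hU : IsOpen U)
    (h : Z ⊆ U) : ∃ a, Z ⊆ basicClopen a ∧ basicClopen a ⊆ U := by
  refine hZ.isCompact.induction_on (p := fun Z => ∃ a, Z ⊆ basicClopen a ∧ basicClopen a ⊆ U)
    ⟨⊥, empty_subset _, fun u hu => (u.bot_notMem hu).elim⟩
    (fun s t hst ⟨a, ha, h⟩ => ⟨a, hst.trans ha, h⟩) ?_ ?_
  · rintro s t ⟨a, ha, ha'⟩ ⟨b, hb, hb'⟩
    refine ⟨a ⊔ b, union_subset (fun u hu => (sup_mem_iff u).2 (.inl (ha hu)))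
      (fun u hu => (sup_mem_iff u).2 (.inr (hb hu))), fun u hu => ?_⟩
    exact ((sup_mem_iff u).1 hu).elim (@ha' u) (@hb' u)
  · intro u hu
    obtain ⟨a, ha, h'⟩ := exists_basicClopen_subset hU (h hu)
    exact ⟨_, mem_nhdsWithin_of_mem_nhds ((isOpen_basicClopen a).mem_nhds ha), a, subset_rfl, h'⟩

/-- A map into the Stone space which is measurable for the basic clopen sets is Baire
measurable. -/
lemma measurable_comp_of_continuous {X : Type*} [MeasurableSpace X] {φ : X → StoneSpace A}
    (hφ : ∀ a, MeasurableSet {x | a ∈ (φ x).carrier}) {f : StoneSpace A → ℝ} (hf : Continuous f) :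
    Measurable fun x => f (φ x) := by
  refine measurable_of_Ioi fun c => ?_
  -- The open set `{f > c}` is the union of these closed sets, hence also a countable union of basic
  -- clopen sets squeezed in between.
  have key : ∀ n : ℕ, ∃ a, {u | c + 1 / ((n : ℝ) + 1) ≤ f u} ⊆ basicClopen a ∧
      basicClopen a ⊆ {u | c < f u} := fun n =>
    exists_basicClopen_between (isClosed_le continuous_const hf) (isOpen_lt continuous_const hf)
      fun u (hu : _ ≤ _) => lt_of_lt_of_le (lt_add_of_pos_right c (by positivity)) hu
  choose a ha ha' using key
  have : (fun x => f (φ x)) ⁻¹' Ioi c = ⋃ n, {x | a n ∈ (φ x).carrier} := by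
    ext x
    simp only [mem_preimage, mem_Ioi, mem_iUnion, mem_ofPred_eq]
    constructor
    · intro hx
      obtain ⟨n, hn⟩ := exists_nat_one_div_lt (sub_pos.2 hx)
      exact ⟨n, ha n (show c + 1 / ((n : ℝ) + 1) ≤ f (φ x) by linarith)⟩
    · rintro ⟨n, hn⟩
      exact ha' n hn
  rw [this]
  exact MeasurableSet.iUnion fun n => hφ _

open scoped CompactlySupported in
/-- A finitely additive, strictly positive measure, given as the law of a random ultrafilter,
induces a regular strictly positive Borel probability measure on the Stone space. -/
theorem supportsMeasure_of_random {X : Type*} [MeasurableSpace X] (P : Measure X)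
    [IsProbabilityMeasure P] (φ : X → StoneSpace A)
    (hφ : ∀ a, MeasurableSet {x | a ∈ (φ x).carrier})
    (hpos : ∀ a, a ≠ ⊥ → P {x | a ∈ (φ x).carrier} ≠ 0) : SupportsMeasure (StoneSpace A) := by
  let : MeasurableSpace (StoneSpace A) := borel _
  have : BorelSpace (StoneSpace A) := ⟨rfl⟩
  have hint : ∀ f : C_c(StoneSpace A, ℝ), Integrable (fun x => f (φ x)) P := fun f => by
    obtain ⟨C, hC⟩ := isCompact_univ.exists_bound_of_continuousOn f.continuous.continuousOn
    exact Integrable.of_bound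
      (measurable_comp_of_continuous hφ f.continuous).aestronglyMeasurable C
      (.of_forall fun x => hC _ trivial)
  let Λ : C_c(StoneSpace A, ℝ) →ₚ[ℝ] ℝ :=
  { toFun g := ∫ x, g (φ x) ∂P
    map_add' g g' := integral_add (hint g) (hint g')
    map_smul' c g := integral_const_mul c _
    monotone' g g' hgg' := integral_mono (hint g) (hint g') fun x => hgg' (φ x) }
  -- The indicator of a clopen set is continuous, so it can be used as a test function.
  have hval : ∀ a : A, RealRMK.rieszMeasure Λ (basicClopen a) = P {x | a ∈ (φ x).carrier} := by
    intro a
    let f : C_c(StoneSpace A, ℝ) :=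
    { toFun := (basicClopen a).indicator fun _ => 1
      continuous_toFun := (isClopen_basicClopen a).continuous_indicator continuous_const
      hasCompactSupport' := HasCompactSupport.of_compactSpace _ }
    have h : ∫ u, f u ∂(RealRMK.rieszMeasure Λ) = ∫ x, f (φ x) ∂P := RealRMK.integral_rieszMeasure Λ f
    have h1 : ∫ u, f u ∂(RealRMK.rieszMeasure Λ) = (RealRMK.rieszMeasure Λ).real (basicClopen a) :=
      integral_indicator_one (isOpen_basicClopen a).measurableSet
    have h2 : ∫ x, f (φ x) ∂P = P.real {x | a ∈ (φ x).carrier} :=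
      integral_indicator_one (hφ a)
    rw [h1, h2] at h
    exact (measureReal_eq_measureReal_iff).1 h
  refine ⟨RealRMK.rieszMeasure Λ, ⟨?_⟩, inferInstance, ⟨fun U hU hne => ?_⟩⟩
  · have : (univ : Set (StoneSpace A)) = basicClopen ⊤ :=
      (eq_univ_of_forall fun u => u.top_mem).symm
    rw [this, hval]
    simp [top_mem]
  · obtain ⟨u, hu⟩ := hne
    obtain ⟨a, ha, h⟩ := exists_basicClopen_subset hU hu
    refine fun h0 => hpos a ?_ ?_
    · rintro rfl; exact u.bot_notMem ha
    · rw [← hval]; exact measure_mono_null h h0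

end StoneSpace

/-! ### Duality for homomorphisms of Boolean algebras -/

namespace StoneSpace

variable {A A' : Type*} [BooleanAlgebra A] [BooleanAlgebra A']

/-- The map between Stone spaces dual to a homomorphism. -/
def comap (g : BoundedLatticeHom A A') (u : StoneSpace A') : StoneSpace A where
  carrier := {a | g a ∈ u.carrier}
  top_mem := by simpa using u.top_mem
  bot_notMem := by simpa using u.bot_notMem
  inf_mem a ha b hb := by simpa using u.inf_mem _ ha _ hb
  mem_of_le a ha b hab := u.mem_of_le _ ha _ (OrderHomClass.mono g hab)
  mem_or_compl_mem a := by simpa [map_compl'] using u.mem_or_compl_mem (g a)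

lemma mem_comap {g : BoundedLatticeHom A A'} {u : StoneSpace A'} {a : A} :
    a ∈ (comap g u).carrier ↔ g a ∈ u.carrier := Iff.rfl

lemma continuous_comap (g : BoundedLatticeHom A A') : Continuous (comap g) :=
  continuous_generateFrom_iff.2 fun _ ⟨a, ha⟩ => ha ▸ isOpen_basicClopen (g a)

lemma comap_injective {g : BoundedLatticeHom A A'} (hg : Function.Surjective g) :
    Function.Injective (comap g) := fun u v h => by
  ext c
  obtain ⟨a, rfl⟩ := hg c
  rw [← mem_comap, h, mem_comap]

/-- An ultrafilter disjoint from the kernel of a surjection pushes forward to an ultrafilter of the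
quotient, and nothing is added when this is pulled back. -/
lemma range_comap {g : BoundedLatticeHom A A'} (hg : Function.Surjective g) :
    range (comap g) = {u | ∀ a ∈ u.carrier, g a ≠ ⊥} := by
  ext u
  constructor
  · rintro ⟨v, rfl⟩ a ha h0
    exact v.bot_notMem (h0 ▸ ha)
  · intro hu
    refine ⟨⟨g '' u.carrier, ⟨⊤, u.top_mem, map_top g⟩, fun ⟨a, ha, h⟩ => hu a ha h, ?_, ?_, ?_⟩, ?_⟩
    · rintro _ ⟨a, ha, rfl⟩ _ ⟨b, hb, rfl⟩
      exact ⟨a ⊓ b, u.inf_mem _ ha _ hb, map_inf g a b⟩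
    · rintro _ ⟨a, ha, rfl⟩ c hac
      obtain ⟨b, rfl⟩ := hg c
      exact ⟨a ⊔ b, u.mem_of_le _ ha _ le_sup_left, by simpa using hac⟩
    · intro c
      obtain ⟨b, rfl⟩ := hg c
      exact (u.mem_or_compl_mem b).imp (fun h => ⟨b, h, rfl⟩) fun h => ⟨bᶜ, h, map_compl' g b⟩
    · ext b
      refine ⟨?_, fun hb => ⟨b, hb, rfl⟩⟩
      rintro ⟨a, ha, hab⟩
      by_contra hb
      refine hu _ (u.inf_mem _ ha _ ((compl_mem_iff u).2 hb)) ?_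
      rw [map_inf, hab, map_compl', inf_compl_eq_bot]

end StoneSpace

/-! ### Growths of `ω` from algebras of sets -/

section Growth

variable {X : Type} (B : BooleanSubalgebra (Set X))

/-- The principal ultrafilter at a point. -/
def principal (x : X) : StoneSpace B where
  carrier := {b | x ∈ b.1}
  top_mem := mem_univ x
  bot_notMem := notMem_empty x
  inf_mem _ ha _ hb := ⟨ha, hb⟩
  mem_of_le _ ha _ hab := hab ha
  mem_or_compl_mem a := em (x ∈ a.1)

/-- The quotient map from a subalgebra of `P(X)` to its image in `P(X)/Fin`. -/
def quotientFin : BoundedLatticeHom B (B.map (PModFin.mkHom X)) where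
  toFun b := ⟨PModFin.mkHom X b, BooleanSubalgebra.mem_map_of_mem _ b.2⟩
  map_sup' _ _ := rfl
  map_inf' _ _ := rfl
  map_top' := rfl
  map_bot' := rfl

lemma quotientFin_surjective : Function.Surjective (quotientFin B) := by
  rintro ⟨_, b, hb, rfl⟩
  exact ⟨⟨b, hb⟩, rfl⟩

lemma PModFin.mk_eq_bot {b : Set X} : PModFin.mk b = ⊥ ↔ b.Finite := by
  change PModFin.mk b = PModFin.mk ∅ ↔ _
  rw [PModFin.mk_eq_mk, ← Set.bot_eq_empty, symmDiff_bot]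

lemma quotientFin_eq_bot {b : B} : quotientFin B b = ⊥ ↔ b.1.Finite := by
  rw [← PModFin.mk_eq_bot]
  exact Subtype.ext_iff

variable {B}

lemma eq_principal_of_finite_mem (hB : ∀ x, {x} ∈ B) {u : StoneSpace B} {b : B}
    (hb : b ∈ u.carrier) (hfin : b.1.Finite) : ∃ x, u = principal B x := by
  by_contra! hne
  have hx : ∀ x, (⟨{x}, hB x⟩ : B) ∉ u.carrier := by
    intro x hx
    refine hne x (StoneSpace.ext (Set.ext fun c => ⟨fun hc => ?_, fun hc => ?_⟩))
    · by_contra hxc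
      have h := u.inf_mem _ hx _ hc
      have h0 : (⟨{x}, hB x⟩ : B) ⊓ c = ⊥ := Subtype.ext (singleton_inter_eq_empty.2 hxc)
      exact u.bot_notMem (h0 ▸ h)
    · exact u.mem_of_le _ hx c (singleton_subset_iff.2 hc)
  have key : ∀ s : Set X, s.Finite → ∀ hs : s ∈ B, (⟨s, hs⟩ : B) ∉ u.carrier := by
    intro s hs
    induction s, hs using Set.Finite.induction_on with
    | empty => exact fun _ => u.bot_notMem
    | @insert a s _ hs ih =>
      intro h hmem
      have hsB : s ∈ B := by
        have := BooleanSubalgebra.biSup_mem (L := B) (f := fun x => ({x} : Set X)) hs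
          fun x _ => hB x
        simpa using this
      have : (⟨insert a s, h⟩ : B) = ⟨{a}, hB a⟩ ⊔ ⟨s, hsB⟩ := Subtype.ext (insert_eq a s)
      rw [this, StoneSpace.sup_mem_iff] at hmem
      exact hmem.elim (hx a) (ih hsB)
  exact key b.1 hfin b.2 hb

/-- If `B` is an algebra of subsets of a countably infinite set containing the singletons, then
the Stone space of `B/Fin` is a growth of `ω`. -/
theorem isGrowthOfOmega_of_singleton_mem (e : ℕ ≃ X) (hB : ∀ x, {x} ∈ B) :
    IsGrowthOfOmega (StoneSpace (B.map (PModFin.mkHom X))) := by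
  have hopen : ∀ x, IsOpen {principal B x} := by
    intro x
    convert StoneSpace.isOpen_basicClopen (⟨{x}, hB x⟩ : B)
    ext u
    constructor
    · rintro rfl
      exact mem_singleton x
    · intro hu
      obtain ⟨y, rfl⟩ := eq_principal_of_finite_mem hB hu (finite_singleton x)
      have : y = x := hu
      rw [this]; rfl
  have hinj : Function.Injective (principal B) := by
    intro x y hxy
    have h : (⟨{x}, hB x⟩ : B) ∈ (principal B x).carrier := mem_singleton x
    rw [hxy] at h
    exact (mem_singleton_iff.1 h).symm
  refine ⟨StoneSpace B, inferInstance, fun n => principal B (e n),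
    ⟨inferInstance, inferInstance, ?_, ?_⟩, ?_⟩
  · refine IsOpenEmbedding.isEmbedding (.of_continuous_injective_isOpenMap
      continuous_of_discreteTopology (hinj.comp e.injective) fun s _ => ?_)
    rw [← biUnion_of_singleton s, image_iUnion₂]
    exact isOpen_biUnion fun n _ => by rw [image_singleton]; exact hopen _
  · rw [DenseRange, StoneSpace.isTopologicalBasis_basicClopen.dense_iff]
    rintro _ ⟨b, rfl⟩ ⟨u, hu⟩
    have hne : b.1.Nonempty := by
      by_contra h
      have : b = ⊥ := Subtype.ext (not_nonempty_iff_eq_empty.1 h)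
      exact u.bot_notMem (this ▸ hu)
    obtain ⟨x, hx⟩ := hne
    exact ⟨principal B x, hx, e.symm x, by simp⟩
  · have hemb : IsEmbedding (StoneSpace.comap (quotientFin B)) :=
      ((StoneSpace.continuous_comap _).isClosedEmbedding
        (StoneSpace.comap_injective (quotientFin_surjective B))).isEmbedding
    refine ⟨hemb.toHomeomorph.trans (Homeomorph.setCongr ?_)⟩
    rw [StoneSpace.range_comap (quotientFin_surjective B)]
    ext u
    constructor
    · rintro hu ⟨n, rfl⟩
      exact hu ⟨{e n}, hB _⟩ (mem_singleton (e n))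
        ((quotientFin_eq_bot B).2 (finite_singleton _))
    · intro hu a ha h0
      obtain ⟨x, rfl⟩ := eq_principal_of_finite_mem hB ha ((quotientFin_eq_bot B).1 h0)
      exact hu ⟨e.symm x, by simp⟩

end Growth

/-! ### The tree of finite slaloms -/

lemma sec_mono {S T : Set (ℕ × ℕ)} (h : S ⊆ T) (n : ℕ) : sec S n ⊆ sec T n := fun _ hm => h hm

lemma slaloms_of_subset {S T : Set (ℕ × ℕ)} (h : S ⊆ T) (hT : T ∈ slaloms) : S ∈ slaloms :=
  fun n => (encard_le_encard (sec_mono h n)).trans_lt (hT n)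

lemma box_mono {m n : ℕ} (h : m ≤ n) : box m ⊆ box n := fun _ hz =>
  ⟨lt_of_lt_of_le hz.1 h, lt_of_lt_of_le hz.2 (Nat.pow_le_pow_right two_pos h)⟩

lemma finite_box (n : ℕ) : (box n).Finite := (finite_Iio _).prod (finite_Iio _)

lemma eventually_mem_box (z : ℕ × ℕ) : ∀ᶠ n in Filter.atTop, z ∈ box n := by
  filter_upwards [Filter.eventually_gt_atTop z.1, Filter.eventually_gt_atTop z.2] with n h1 h2
  exact ⟨h1, lt_trans h2 Nat.lt_two_pow_self⟩

/-- The node at height `n` of the branch given by the slalom `S`. -/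
def node (S : Set (ℕ × ℕ)) (hS : S ∈ slaloms) (n : ℕ) : Omega :=
  ⟨(S ∩ box n, n), slaloms_of_subset inter_subset_left hS, inter_subset_right⟩

lemma node_injective {S : Set (ℕ × ℕ)} (hS : S ∈ slaloms) : Function.Injective (node S hS) :=
  fun _ _ h => congrArg (fun p : Omega => p.1.2) h

lemma empty_mem_slaloms : (∅ : Set (ℕ × ℕ)) ∈ slaloms := fun n => by
  have : sec ∅ n = ∅ := eq_empty_of_forall_notMem fun _ h => h
  rw [this, encard_empty]
  exact_mod_cast Nat.two_pow_pos n

lemma finite_level (n : ℕ) : {q : Omega | q.1.2 = n}.Finite := by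
  refine Finite.subset (((finite_box n).powerset.prod (finite_singleton n)).preimage
    Subtype.val_injective.injOn) ?_
  rintro ⟨⟨S, k⟩, hS, hk⟩ (rfl : k = n)
  exact ⟨hk, rfl⟩

instance : Countable Omega := by
  rw [← countable_univ_iff]
  have : (univ : Set Omega) = ⋃ n, {q : Omega | q.1.2 = n} :=
    (eq_univ_of_forall fun q => mem_iUnion.2 ⟨q.1.2, rfl⟩).symm
  rw [this]
  exact countable_iUnion fun n => (finite_level n).countable

instance : Infinite Omega := Infinite.of_injective _ (node_injective empty_mem_slaloms)

lemma finite_levels_below (n : ℕ) : {q : Omega | q.1.2 ≤ n}.Finite := by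
  refine ((finite_le_nat n).biUnion fun k _ => finite_level k).subset fun q hq => ?_
  exact mem_biUnion (x := q.1.2) hq rfl

variable {𝒜 : Set (Set (ℕ × ℕ))}

lemma TSet_mem_slalomAlgebra {W : Set (ℕ × ℕ)} (hW : W ∈ 𝒜) : TSet W ∈ slalomAlgebra 𝒜 :=
  BooleanSubalgebra.subset_closure (.inl ⟨W, hW, rfl⟩)

lemma TNode_mem_slalomAlgebra (q : Omega) : TNode q ∈ slalomAlgebra 𝒜 :=
  BooleanSubalgebra.subset_closure (.inr ⟨q, rfl⟩)

lemma slalomAlgebra_induction {p : Set Omega → Prop} (hT : ∀ W ∈ 𝒜, p (TSet W))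
    (hN : ∀ q, p (TNode q)) (hbot : p ∅) (hsup : ∀ b c, p b → p c → p (b ∪ c))
    (hcompl : ∀ b, p b → p bᶜ) {b : Set Omega} (hb : b ∈ slalomAlgebra 𝒜) : p b := by
  refine BooleanSubalgebra.closure_bot_sup_induction (p := fun b _ => p b) ?_ hbot
    (fun b _ c _ => hsup b c) (fun b _ => hcompl b) hb
  rintro _ (⟨W, hW, rfl⟩ | ⟨q, rfl⟩)
  exacts [hT W hW, hN q]

lemma singleton_mem_slalomAlgebra (q : Omega) : {q} ∈ slalomAlgebra 𝒜 := by
  -- The cone above `q` minus the finitely many cones of the next level is `q` alone.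
  have : ({q} : Set Omega) =
      TNode q \ ⨆ q' ∈ {q' : Omega | q'.1.2 = q.1.2 + 1}, TNode q' := by
    ext p
    simp only [mem_singleton_iff, Set.iSup_eq_iUnion, mem_sdiff, mem_iUnion, not_exists]
    constructor
    · rintro rfl
      refine ⟨⟨le_rfl, inter_eq_left.2 p.2.2⟩, fun q' (h : _ = _) hp => ?_⟩
      have := hp.1
      omega
    · rintro ⟨⟨h1, h2⟩, h3⟩
      have hle : p.1.2 ≤ q.1.2 := by
        by_contra! hlt
        refine h3 ⟨(p.1.1 ∩ box (q.1.2 + 1), q.1.2 + 1),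
          slaloms_of_subset inter_subset_left p.2.1, inter_subset_right⟩ rfl ⟨hlt, rfl⟩
      have heq : p.1.2 = q.1.2 := le_antisymm hle h1
      refine Subtype.ext (Prod.ext ?_ heq)
      rw [← h2, ← heq]
      exact (inter_eq_left.2 p.2.2).symm
  rw [this]
  exact BooleanSubalgebra.sdiff_mem (TNode_mem_slalomAlgebra q)
    (BooleanSubalgebra.biSup_mem (finite_level _) fun q' _ => TNode_mem_slalomAlgebra q')

theorem isGrowthOfOmega_KSpace : IsGrowthOfOmega (KSpace 𝒜) :=
  isGrowthOfOmega_of_singleton_mem (nonempty_equiv_of_countable (α := ℕ) (β := Omega)).some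
    singleton_mem_slalomAlgebra

/-! ### Ultrafilters given by branches -/

/-- The quotient map from `𝔗_𝒜` to `𝔗_𝒜/Fin`. -/
def quotientHom (𝒜 : Set (Set (ℕ × ℕ))) :
    BoundedLatticeHom (slalomAlgebra 𝒜) (slalomAlgebraModFin 𝒜) := quotientFin (slalomAlgebra 𝒜)

lemma quotientHom_surjective : Function.Surjective (quotientHom 𝒜) := quotientFin_surjective _

lemma quotientHom_eq_bot {b : slalomAlgebra 𝒜} : quotientHom 𝒜 b = ⊥ ↔ b.1.Finite :=
  quotientFin_eq_bot _

lemma node_mem_TSet {S W : Set (ℕ × ℕ)} {hS : S ∈ slaloms} {n : ℕ} :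
    node S hS n ∈ TSet W ↔ W ∩ box n ⊆ S :=
  ⟨fun h => h.trans inter_subset_left, fun h => subset_inter h inter_subset_right⟩

lemma eventually_node_mem_TSet_iff {S W : Set (ℕ × ℕ)} {hS : S ∈ slaloms} :
    (∀ᶠ n in Filter.atTop, node S hS n ∈ TSet W) ↔ W ⊆ S := by
  simp only [node_mem_TSet]
  refine ⟨fun h z hz => ?_, fun h => .of_forall fun n => inter_subset_left.trans h⟩
  obtain ⟨n, h1, h2⟩ := (h.and (eventually_mem_box z)).exists
  exact h1 ⟨hz, h2⟩

/-- On generators the decision is explicit: a point of `W` outside `S` eventually enters the box and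
excludes `T_W`, and membership in a cone depends only on the trace on a fixed box. -/
lemma eventually_node_mem_or {S : Set (ℕ × ℕ)} (hS : S ∈ slaloms) {b : Set Omega}
    (hb : b ∈ slalomAlgebra 𝒜) :
    (∀ᶠ n in Filter.atTop, node S hS n ∈ b) ∨ ∀ᶠ n in Filter.atTop, node S hS n ∉ b := by
  refine slalomAlgebra_induction (p := fun b => (∀ᶠ n in Filter.atTop, node S hS n ∈ b) ∨
    ∀ᶠ n in Filter.atTop, node S hS n ∉ b) (fun W hW => ?_) (fun q => ?_)
    (.inr (.of_forall fun _ => notMem_empty _)) (fun b c hb hc => ?_)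
    (fun b hb => hb.symm.imp id fun h => h.mono fun _ => not_not.2) hb
  · by_cases h : W ⊆ S
    · exact .inl (eventually_node_mem_TSet_iff.2 h)
    · obtain ⟨z, hz, hzS⟩ := not_subset.1 h
      refine .inr ((eventually_mem_box z).mono fun n hn k => hzS ?_)
      exact node_mem_TSet.1 k ⟨hz, hn⟩
  · by_cases h : S ∩ box q.1.2 = q.1.1
    · refine .inl ((Filter.eventually_ge_atTop q.1.2).mono fun n hn => ⟨hn, ?_⟩)
      rwa [node, inter_assoc, inter_eq_right.2 (box_mono hn)]
    · refine .inr ((Filter.eventually_ge_atTop q.1.2).mono fun n hn k => h ?_)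
      have := k.2
      rwa [node, inter_assoc, inter_eq_right.2 (box_mono hn)] at this
  · rcases hb with hb | hb
    · exact .inl (hb.mono fun _ h => .inl h)
    · rcases hc with hc | hc
      · exact .inl (hc.mono fun _ h => .inr h)
      · exact .inr ((hb.and hc).mono fun _ h => not_or.2 h)

lemma infinite_of_eventually_node_mem {S : Set (ℕ × ℕ)} {hS : S ∈ slaloms} {b : Set Omega}
    (h : ∀ᶠ n in Filter.atTop, node S hS n ∈ b) : b.Infinite := fun hb =>
  Nat.frequently_atTop_iff_infinite.1 h.frequently (hb.preimage (node_injective hS).injOn)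

/-- The ultrafilter of the algebra generated by the nodes of a branch. -/
def branchUltrafilter (𝒜 : Set (Set (ℕ × ℕ))) (S : Set (ℕ × ℕ)) (hS : S ∈ slaloms) :
    StoneSpace (slalomAlgebra 𝒜) where
  carrier := {b | ∀ᶠ n in Filter.atTop, node S hS n ∈ b.1}
  top_mem := .of_forall fun _ => mem_univ _
  bot_notMem h := infinite_of_eventually_node_mem h finite_empty
  inf_mem _ ha _ hb := ha.and hb
  mem_of_le _ ha _ hab := ha.mono fun _ h => hab h
  mem_or_compl_mem a := eventually_node_mem_or hS a.2

lemma exists_branch (𝒜 : Set (Set (ℕ × ℕ))) (S : Set (ℕ × ℕ)) (hS : S ∈ slaloms) :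
    ∃ u : KSpace 𝒜, StoneSpace.comap (quotientHom 𝒜) u =
      branchUltrafilter 𝒜 S hS := by
  have : branchUltrafilter 𝒜 S hS ∈ range (StoneSpace.comap (quotientHom 𝒜)) := by
    rw [StoneSpace.range_comap (quotientHom_surjective)]
    exact fun b hb h0 => infinite_of_eventually_node_mem hb (quotientHom_eq_bot.1 h0)
  exact this

/-- The point of `K_𝒜` given by a branch of the tree of finite slaloms. -/
noncomputable def branch (𝒜 : Set (Set (ℕ × ℕ))) (S : Set (ℕ × ℕ)) (hS : S ∈ slaloms) :
    KSpace 𝒜 := (exists_branch 𝒜 S hS).choose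

lemma quotientHom_mem_branch {S : Set (ℕ × ℕ)} {hS : S ∈ slaloms} {b : slalomAlgebra 𝒜} :
    quotientHom 𝒜 b ∈ (branch 𝒜 S hS).carrier ↔
      ∀ᶠ n in Filter.atTop, node S hS n ∈ b.1 := by
  rw [← StoneSpace.mem_comap, branch, (exists_branch 𝒜 S hS).choose_spec]
  rfl

/-- The element of `𝔗_𝒜/Fin` given by `T_W`. -/
def genClass {W : Set (ℕ × ℕ)} (hW : W ∈ 𝒜) : slalomAlgebraModFin 𝒜 :=
  quotientHom 𝒜 ⟨TSet W, TSet_mem_slalomAlgebra hW⟩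

lemma genClass_mem_branch {S W : Set (ℕ × ℕ)} {hS : S ∈ slaloms} {hW : W ∈ 𝒜} :
    genClass hW ∈ (branch 𝒜 S hS).carrier ↔ W ⊆ S :=
  quotientHom_mem_branch.trans eventually_node_mem_TSet_iff

lemma genClass_anti {V W : Set (ℕ × ℕ)} (hV : V ∈ 𝒜) (hW : W ∈ 𝒜) (h : V ⊆ W) :
    genClass hW ≤ genClass hV :=
  OrderHomClass.mono (quotientHom 𝒜)
    (fun _ hp => (inter_subset_inter_left _ h).trans hp : TSet W ⊆ TSet V)

/-! ### Non-separability -/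

lemma familyW_of_subset {V W : Set (ℕ × ℕ)} (h : V ⊆ W) (hW : W ∈ familyW) : V ∈ familyW := by
  refine ⟨⟨fun n m hm => hW.1.1 n (h hm), hW.1.2.of_nonneg_of_le (fun n => by positivity)
    fun n => ?_⟩, slaloms_of_subset h hW.2⟩
  gcongr
  · exact (finite_Iio _).subset (hW.1.1 n)
  · exact fun m hm => h hm

/-- Column `0` has to be dropped, since a slalom satisfies `|S(0)| < 1`. -/
lemma graph_mem_familyW {f : ℕ → ℕ} (hf : ∀ n, f n < 2 ^ n) :
    {z : ℕ × ℕ | 1 ≤ z.1 ∧ z.2 = f z.1} ∈ familyW := by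
  have hsub : ∀ n, sec {z : ℕ × ℕ | 1 ≤ z.1 ∧ z.2 = f z.1} n ⊆ {f n} := fun n m hm => hm.2
  refine ⟨⟨fun n => (hsub n).trans (singleton_subset_iff.2 (hf n)), ?_⟩, fun n => ?_⟩
  · refine summable_geometric_two.of_nonneg_of_le (fun n => by positivity) fun n => ?_
    rw [one_div, inv_pow, ← one_div]
    gcongr
    have := ncard_le_ncard (hsub n)
    rw [ncard_singleton] at this
    exact_mod_cast this
  · rcases Nat.eq_zero_or_pos n with rfl | hn
    · have : sec {z : ℕ × ℕ | 1 ≤ z.1 ∧ z.2 = f z.1} 0 = ∅ :=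
        eq_empty_of_forall_notMem fun m hm => absurd hm.1 (by simp)
      rw [this, encard_empty]
      simp
    · refine (encard_le_encard (hsub n)).trans_lt ?_
      rw [encard_singleton]
      exact_mod_cast Nat.one_lt_two_pow hn.ne'

lemma singleton_mem_familyW {n m : ℕ} (hn : 1 ≤ n) (hm : m < 2 ^ n) : {(n, m)} ∈ familyW := by
  refine familyW_of_subset ?_ (graph_mem_familyW (f := fun k => if k = n then m else 0) ?_)
  · rintro _ rfl
    exact ⟨hn, by simp⟩
  · intro k
    split_ifs with h
    · rwa [h]
    · exact Nat.two_pow_pos k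

lemma StoneSpace.finsetInf_mem {A ι : Type*} [BooleanAlgebra A] (u : StoneSpace A) (s : Finset ι)
    (f : ι → A) (h : ∀ i ∈ s, f i ∈ u.carrier) : s.inf f ∈ u.carrier :=
  Finset.inf_induction u.top_mem (fun _ ha _ hb => u.inf_mem _ ha _ hb) h

/-- A point of the space omits some point in each column. -/
lemma exists_genClass_singleton_notMem (u : KSpace familyW) {n : ℕ} (hn : 1 ≤ n) :
    ∃ m, ∃ hm : m < 2 ^ n, genClass (singleton_mem_familyW hn hm) ∉ u.carrier := by
  by_contra! h
  let f : Fin (2 ^ n) → slalomAlgebra familyW := fun m =>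
    ⟨TSet {(n, (m : ℕ))}, TSet_mem_slalomAlgebra (singleton_mem_familyW hn m.2)⟩
  have hmem := (StoneSpace.comap (quotientHom familyW) u).finsetInf_mem
    Finset.univ f fun m _ => h m m.2
  refine u.bot_notMem ?_
  rw [StoneSpace.mem_comap, quotientHom_eq_bot.2] at hmem
  · exact hmem
  -- A node higher than `n` lying in all these sets would contain the full column `n`, against the
  -- slalom bound.
  · refine (finite_levels_below n).subset fun p hp => ?_
    by_contra hlt
    rw [mem_ofPred_eq, not_le] at hlt
    have hsub : Iio (2 ^ n) ⊆ sec p.1.1 n := fun m hm => by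
      have : p ∈ (f ⟨m, hm⟩).1 :=
        (Finset.inf_le (Finset.mem_univ _) : Finset.univ.inf f ≤ f ⟨m, hm⟩) hp
      exact this ⟨rfl, hlt, lt_of_lt_of_le hm (Nat.pow_le_pow_right two_pos hlt.le)⟩
    have h1 := (encard_le_encard hsub).trans_lt (p.2.1 n)
    rw [← Nat.cast_inj (R := ℕ∞) |>.2 (by simp : (Iio (2 ^ n)).ncard = 2 ^ n),
      (finite_Iio _).cast_ncard_eq] at h1
    exact lt_irrefl _ h1

theorem not_separableSpace_KSpace : ¬ TopologicalSpace.SeparableSpace (KSpace familyW) := by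
  intro _
  have : Nonempty (KSpace familyW) := ⟨branch _ ∅ empty_mem_slaloms⟩
  obtain ⟨u, hu⟩ := TopologicalSpace.exists_dense_seq (KSpace familyW)
  choose m hm hnot using fun k => exists_genClass_singleton_notMem (u k) (Nat.succ_pos k)
  -- The `k`-th point is defeated in column `k + 1`. The remainder changes nothing there; it only
  -- secures the bound in column `0`, which the graph omits.
  let f : ℕ → ℕ := fun n => m (n - 1) % 2 ^ n
  have hW := graph_mem_familyW (f := f) fun n => Nat.mod_lt _ (Nat.two_pow_pos n)
  obtain ⟨k, hk⟩ := hu.exists_mem_open (StoneSpace.isOpen_basicClopen (genClass hW))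
    ⟨branch _ _ hW.2, genClass_mem_branch.2 subset_rfl⟩
  refine hnot k ((u k).mem_of_le _ hk _ (genClass_anti _ _ ?_))
  rintro _ rfl
  exact ⟨Nat.succ_pos k, (Nat.mod_eq_of_lt (hm k)).symm⟩

/-! ### Dyadic approximations and the map onto the cube -/

/-- The integer part of `2 ^ k` times the fractional part of `t`. -/
noncomputable def dyadic (k : ℕ) (t : ℝ) : ℕ := ⌊Int.fract t * 2 ^ k⌋₊

lemma dyadic_lt (k : ℕ) (t : ℝ) : dyadic k t < 2 ^ k := by
  rw [dyadic, Nat.floor_lt (mul_nonneg (Int.fract_nonneg t) (by positivity))]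
  push_cast
  exact mul_lt_of_lt_one_left (by positivity) (Int.fract_lt_one t)

lemma dyadic_eq_iff {k j : ℕ} {t : ℝ} (ht : t ∈ Ico (0 : ℝ) 1) :
    dyadic k t = j ↔ (j : ℝ) / 2 ^ k ≤ t ∧ t < (j + 1 : ℝ) / 2 ^ k := by
  rw [dyadic, Int.fract_eq_self.2 ht, Nat.floor_eq_iff (mul_nonneg ht.1 (by positivity)),
    div_le_iff₀ (by positivity), lt_div_iff₀ (by positivity)]

lemma eventually_dyadic_ne {s t : ℝ} (hs : s ∈ Ico (0 : ℝ) 1) (ht : t ∈ Ico (0 : ℝ) 1)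
    (hst : s ≠ t) : ∀ᶠ k in Filter.atTop, dyadic k s ≠ dyadic k t := by
  have h := (tendsto_pow_atTop_nhds_zero_of_lt_one (r := (1 / 2 : ℝ)) (by norm_num)
    (by norm_num)).eventually (gt_mem_nhds (abs_pos.2 (sub_ne_zero.2 hst)))
  filter_upwards [h] with k hk heq
  have h1 := (dyadic_eq_iff hs).1 heq
  have h2 := (dyadic_eq_iff (k := k) ht).1 rfl
  have h3 : (dyadic k t + 1 : ℝ) / 2 ^ k = dyadic k t / 2 ^ k + (1 / 2) ^ k := by
    rw [add_div, one_div, one_div, inv_pow]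
  rw [h3] at h1 h2
  exact hk.not_gt (abs_sub_lt_iff.2 ⟨by linarith, by linarith⟩)

/-- The graph of the dyadic approximations of `y`, shifted by one column. -/
def dyadicGraph (y : ℝ) : Set (ℕ × ℕ) := {z | 1 ≤ z.1 ∧ z.2 = dyadic (z.1 - 1) y}

lemma dyadicGraph_mem_familyW (y : ℝ) : dyadicGraph y ∈ familyW :=
  graph_mem_familyW (f := fun n => dyadic (n - 1) y) fun n =>
    (dyadic_lt _ y).trans_le (Nat.pow_le_pow_right two_pos (Nat.sub_le n 1))

/-- This is what the shift by one column is for: all graphs together use only `2 ^ (n - 1)` values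
in column `n ≥ 1`. -/
lemma biUnion_dyadicGraph_mem_slaloms (J : Set ℝ) : (⋃ y ∈ J, dyadicGraph y) ∈ slaloms := by
  intro n
  have hsub : sec (⋃ y ∈ J, dyadicGraph y) n ⊆ {m | 1 ≤ n ∧ m < 2 ^ (n - 1)} := by
    intro m hm
    obtain ⟨y, -, h1, h2⟩ := mem_iUnion₂.1 hm
    exact ⟨h1, (congrArg (· < 2 ^ (n - 1)) h2).mpr (dyadic_lt _ y)⟩
  refine (encard_le_encard hsub).trans_lt ?_
  rcases Nat.eq_zero_or_pos n with rfl | hn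
  · simp
  · have : {m | 1 ≤ n ∧ m < 2 ^ (n - 1)} = Iio (2 ^ (n - 1)) := by
      ext m; exact and_iff_right hn
    rw [this, ← (finite_Iio _).cast_ncard_eq, ← Finset.coe_Iio, ncard_coe_finset, Nat.card_Iio]
    exact_mod_cast Nat.pow_lt_pow_right one_lt_two (Nat.sub_lt hn one_pos)

lemma not_dyadicGraph_subset {J : Set ℝ} (hJ : J.Finite) (hJ1 : J ⊆ Ico 0 1) {y : ℝ}
    (hy : y ∈ Ico (0 : ℝ) 1) (hyJ : y ∉ J) : ¬ dyadicGraph y ⊆ ⋃ x ∈ J, dyadicGraph x := by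
  intro h
  have hev : ∀ᶠ k in Filter.atTop, ∀ x ∈ J, dyadic k y ≠ dyadic k x :=
    (Filter.eventually_all_finite hJ).2 fun x hx =>
      eventually_dyadic_ne hy (hJ1 hx) fun h => hyJ (h ▸ hx)
  obtain ⟨k, hk⟩ := hev.exists
  have hmem : (k + 1, dyadic k y) ∈ dyadicGraph y := ⟨Nat.succ_pos k, rfl⟩
  obtain ⟨x, hx, hx'⟩ := mem_iUnion₂.1 (h hmem)
  exact hk x hx hx'.2

open scoped Classical in
/-- The map of `K` to the Cantor cube given by an independent family of size continuum. -/
noncomputable def toCantorCube (u : KSpace familyW) (y : Ico (0 : ℝ) 1) : Bool :=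
  decide (genClass (dyadicGraph_mem_familyW y) ∈ u.carrier)

lemma isClopen_toCantorCube_eq (y : Ico (0 : ℝ) 1) (c : Bool) :
    IsClopen {u | toCantorCube u y = c} := by
  cases c
  · convert (StoneSpace.isClopen_basicClopen (genClass (dyadicGraph_mem_familyW y))).compl
    ext u
    simp [toCantorCube, StoneSpace.mem_basicClopen]
  · convert StoneSpace.isClopen_basicClopen (genClass (dyadicGraph_mem_familyW y))
    ext u
    simp [toCantorCube, StoneSpace.mem_basicClopen]

lemma continuous_toCantorCube : Continuous toCantorCube :=
  continuous_pi fun y => continuous_discrete_rng.2 fun c => (isClopen_toCantorCube_eq y c).isOpen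

-- By compactness it suffices to realise finitely many coordinates, and the branch of the union of
-- the graphs prescribed to be `true` does so.
open scoped Classical in
lemma toCantorCube_surjective : Function.Surjective toCantorCube := by
  intro x
  suffices h : (⋂ y, {u | toCantorCube u y = x y}).Nonempty by
    obtain ⟨u, hu⟩ := h
    exact ⟨u, funext fun y => mem_iInter.1 hu y⟩
  refine CompactSpace.iInter_nonempty (fun y => (isClopen_toCantorCube_eq y _).isClosed) fun I => ?_
  let J : Set ℝ := (↑) '' {y : Ico (0 : ℝ) 1 | y ∈ I ∧ x y = true}
  have hJ : J.Finite := (I.finite_toSet.subset fun y hy => hy.1).image _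
  have hJ1 : J ⊆ Ico 0 1 := by
    rintro _ ⟨y, -, rfl⟩
    exact y.2
  refine ⟨branch _ _ (biUnion_dyadicGraph_mem_slaloms J), mem_iInter₂.2 fun y hy => ?_⟩
  rw [mem_ofPred_eq, toCantorCube]
  cases hxy : x y
  · rw [decide_eq_false_iff_not, genClass_mem_branch]
    refine not_dyadicGraph_subset hJ hJ1 y.2 ?_
    rintro ⟨y', ⟨-, h⟩, h'⟩
    rw [Subtype.ext h', hxy] at h
    exact Bool.false_ne_true h
  · rw [decide_eq_true_iff, genClass_mem_branch]
    exact subset_biUnion_of_mem (u := dyadicGraph) ⟨y, ⟨hy, hxy⟩, rfl⟩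

theorem exists_continuous_surjective_cube (ι : Type) (hι : #ι = 𝔠) :
    ∃ f : KSpace familyW → (ι → unitInterval), Continuous f ∧ Function.Surjective f := by
  -- Each coordinate of the cube receives its own block of countably many binary digits.
  have hcard : #(ι × ℕ) = #(Ico (0 : ℝ) 1) := by
    rw [mk_prod, lift_id, lift_id, hι, mk_nat, continuum_mul_aleph0, mk_Ico_real one_pos]
  obtain ⟨e⟩ := Cardinal.eq.1 hcard
  refine ⟨fun u i => Real.fromBinary fun n => toCantorCube u (e (i, n)), ?_, fun x => ?_⟩
  · exact continuous_pi fun i => Real.fromBinary_continuous.comp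
      (continuous_pi fun n => (continuous_apply _).comp continuous_toCantorCube)
  · choose c hc using fun i => Real.fromBinary_surjective (x i)
    obtain ⟨u, hu⟩ := toCantorCube_surjective fun y => c (e.symm y).1 (e.symm y).2
    refine ⟨u, funext fun i => ?_⟩
    rw [← hc i]
    simp [hu]

/-! ### A random branch -/

/-- Up to a finite set of nodes, membership in an element of the algebra depends only on a
finite part of a node and on finitely many generators. -/
lemma exists_finite_determination {𝒜 : Set (Set (ℕ × ℕ))} {b : Set Omega}
    (hb : b ∈ slalomAlgebra 𝒜) :
    ∃ F : Finset (Set (ℕ × ℕ)), ↑F ⊆ 𝒜 ∧ ∃ N, ∀ p p' : Omega, N ≤ p.1.2 → N ≤ p'.1.2 →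
      p.1.1 ∩ box N = p'.1.1 ∩ box N → (∀ W ∈ F, p ∈ TSet W ↔ p' ∈ TSet W) →
      (p ∈ b ↔ p' ∈ b) := by
  classical
  refine slalomAlgebra_induction (p := fun b => ∃ F : Finset (Set (ℕ × ℕ)), ↑F ⊆ 𝒜 ∧ ∃ N,
    ∀ p p' : Omega, N ≤ p.1.2 → N ≤ p'.1.2 → p.1.1 ∩ box N = p'.1.1 ∩ box N →
      (∀ W ∈ F, p ∈ TSet W ↔ p' ∈ TSet W) → (p ∈ b ↔ p' ∈ b))
    (fun W hW => ?_) (fun q => ?_) ?_ ?_ ?_ hb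
  · exact ⟨{W}, by simpa using hW, 0, fun p p' _ _ _ h => h W (Finset.mem_singleton_self W)⟩
  · refine ⟨∅, by simp, q.1.2, fun p p' hp hp' h _ => ?_⟩
    exact and_congr (iff_of_true hp hp') (by rw [h])
  · exact ⟨∅, by simp, 0, fun _ _ _ _ _ _ => Iff.rfl⟩
  · rintro b c ⟨F, hF, N, h⟩ ⟨F', hF', N', h'⟩
    refine ⟨F ∪ F', by simp [hF, hF'], max N N', fun p p' hp hp' hpp hT => ?_⟩
    have hbox : ∀ k ≤ max N N', p.1.1 ∩ box k = p'.1.1 ∩ box k := fun k hk => by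
      rw [← inter_eq_right.2 (box_mono hk), ← inter_assoc, hpp, inter_assoc]
    exact or_congr
      (h p p' (le_of_max_le_left hp) (le_of_max_le_left hp') (hbox _ (le_max_left _ _))
        fun W hW => hT W (Finset.mem_union_left _ hW))
      (h' p p' (le_of_max_le_right hp) (le_of_max_le_right hp') (hbox _ (le_max_right _ _))
        fun W hW => hT W (Finset.mem_union_right _ hW))
  · rintro b ⟨F, hF, N, h⟩
    exact ⟨F, hF, N, fun p p' hp hp' hpp hT => not_congr (h p p' hp hp' hpp hT)⟩

/-- The slalom which extends the node `p` and, in each later column `k`, consists of all elements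
of `2 ^ k` but one, the omitted one being read off from `t`. -/
def extendOmitting (p : Omega) (t : ℝ) : Set (ℕ × ℕ) :=
  {z | z ∈ p.1.1 ∨ p.1.2 ≤ z.1 ∧ z.2 < 2 ^ z.1 ∧ z.2 ≠ dyadic z.1 t}

lemma extendOmitting_inter_box (p : Omega) (t : ℝ) :
    extendOmitting p t ∩ box p.1.2 = p.1.1 := by
  ext z
  refine ⟨?_, fun hz => ⟨.inl hz, p.2.2 hz⟩⟩
  rintro ⟨hz | hz, hb⟩
  · exact hz
  · exact absurd hb.1 (not_lt.2 hz.1)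

lemma extendOmitting_mem_slaloms (p : Omega) (t : ℝ) : extendOmitting p t ∈ slaloms := by
  intro n
  rcases lt_or_ge n p.1.2 with hn | hn
  · have hsub : sec (extendOmitting p t) n ⊆ sec p.1.1 n := fun m hm =>
      hm.elim id fun h => absurd hn (not_lt.2 h.1)
    exact (encard_le_encard hsub).trans_lt (p.2.1 n)
  · have hsub : sec (extendOmitting p t) n ⊂ Iio (2 ^ n) := by
      rw [ssubset_iff_of_subset]
      · refine ⟨dyadic n t, dyadic_lt n t, ?_⟩
        rintro (h | h)
        · exact absurd (p.2.2 h).1 (not_lt.2 hn)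
        · exact h.2.2 rfl
      · rintro m (h | h)
        · exact absurd (p.2.2 h).1 (not_lt.2 hn)
        · exact h.2.1
    refine ((finite_Iio _).subset hsub.1).encard_lt_encard hsub |>.trans_le ?_
    rw [← (finite_Iio _).cast_ncard_eq, ← Finset.coe_Iio, ncard_coe_finset, Nat.card_Iio]

lemma measurable_dyadic (k : ℕ) : Measurable (dyadic k) :=
  Nat.measurable_floor.comp (measurable_fract.mul_const _)

/-- The random branch. -/
noncomputable def randomBranch (x : Omega × ℝ) : KSpace familyW :=
  branch familyW (extendOmitting x.1 x.2) (extendOmitting_mem_slaloms x.1 x.2)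

instance : MeasurableSpace Omega := ⊤

instance : DiscreteMeasurableSpace Omega := ⟨fun _ => trivial⟩

lemma measurableSet_mem_extendOmitting (z : ℕ × ℕ) :
    MeasurableSet {x : Omega × ℝ | z ∈ extendOmitting x.1 x.2} := by
  have h1 : MeasurableSet {x : Omega × ℝ | z ∈ x.1.1.1} :=
    measurable_fst (MeasurableSet.of_discrete (s := {p : Omega | z ∈ p.1.1}))
  have h2 : MeasurableSet {x : Omega × ℝ | x.1.1.2 ≤ z.1} :=
    measurable_fst (MeasurableSet.of_discrete (s := {p : Omega | p.1.2 ≤ z.1}))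
  have h3 : MeasurableSet {x : Omega × ℝ | z.2 ≠ dyadic z.1 x.2} :=
    ((measurable_dyadic z.1).comp measurable_snd)
      (MeasurableSet.of_discrete (s := {j : ℕ | z.2 ≠ j}))
  exact h1.union (h2.inter ((MeasurableSet.const _).inter h3))

lemma measurable_node_extendOmitting (n : ℕ) : Measurable fun x : Omega × ℝ =>
    node (extendOmitting x.1 x.2) (extendOmitting_mem_slaloms x.1 x.2) n := by
  refine measurable_to_countable' fun q => ?_
  have : (fun x : Omega × ℝ =>
      node (extendOmitting x.1 x.2) (extendOmitting_mem_slaloms x.1 x.2) n) ⁻¹' {q} =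
      {_x | n = q.1.2} ∩ ⋂ z, {x | z ∈ extendOmitting x.1 x.2 ∧ z ∈ box n ↔ z ∈ q.1.1} := by
    ext x
    simp only [mem_preimage, mem_singleton_iff, mem_inter_iff, mem_iInter, mem_ofPred_eq]
    refine ⟨?_, fun h => Subtype.ext (Prod.ext (Set.ext h.2) h.1)⟩
    rintro rfl
    exact ⟨rfl, fun _ => Iff.rfl⟩
  rw [this]
  refine (MeasurableSet.const _).inter (MeasurableSet.iInter fun z => ?_)
  have h := (measurableSet_mem_extendOmitting z).inter (MeasurableSet.const (z ∈ box n))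
  by_cases hz : z ∈ q.1.1
  · simp only [hz, iff_true]
    exact h
  · simp only [hz, iff_false]
    exact h.compl

lemma measurableSet_mem_randomBranch (c : slalomAlgebraModFin familyW) :
    MeasurableSet {x | c ∈ (randomBranch x).carrier} := by
  obtain ⟨b, rfl⟩ := quotientHom_surjective c
  simp only [randomBranch, quotientHom_mem_branch]
  have h : {x : Omega × ℝ | ∀ᶠ n in Filter.atTop,
      node (extendOmitting x.1 x.2) (extendOmitting_mem_slaloms x.1 x.2) n ∈ b.1} =
      ⋃ N, ⋂ n ≥ N, {x | node (extendOmitting x.1 x.2)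
        (extendOmitting_mem_slaloms x.1 x.2) n ∈ b.1} := by
    ext x
    simp
  rw [h]
  exact MeasurableSet.iUnion fun N => MeasurableSet.biInter (to_countable _) fun n _ =>
    measurable_node_extendOmitting n (MeasurableSet.of_discrete (s := b.1))

/-! ### The law of the random branch and its strict positivity -/

/-- The uniform measure on the unit interval. -/
noncomputable def unitMeasure : Measure ℝ := volume.restrict (Ico 0 1)

instance : IsProbabilityMeasure unitMeasure := ⟨by simp [unitMeasure]⟩

lemma unitMeasure_dyadic_mem_le (k : ℕ) {A : Set ℕ} (hA : A.Finite) :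
    unitMeasure {t | dyadic k t ∈ A} ≤ ENNReal.ofReal (A.ncard / 2 ^ k) := by
  have h1 : ∀ j : ℕ, unitMeasure {t | dyadic k t = j} ≤ ENNReal.ofReal (1 / 2 ^ k) := fun j => by
    have hm : MeasurableSet {t | dyadic k t = j} :=
      measurable_dyadic k (measurableSet_singleton j)
    rw [unitMeasure, Measure.restrict_apply hm]
    refine (measure_mono (t := Ico ((j : ℝ) / 2 ^ k) ((j + 1 : ℝ) / 2 ^ k))
      fun t ht => (dyadic_eq_iff ht.2).1 ht.1).trans ?_
    rw [Real.volume_Ico, ← sub_div, add_sub_cancel_left]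
  have h2 : {t | dyadic k t ∈ A} = ⋃ j ∈ hA.toFinset, {t | dyadic k t = j} := by
    ext t; simp
  rw [h2]
  refine (measure_biUnion_finset_le _ _).trans ((Finset.sum_le_sum fun j _ => h1 j).trans ?_)
  rw [Finset.sum_const, nsmul_eq_mul, ncard_eq_toFinset_card A hA, ← ENNReal.ofReal_natCast,
    ← ENNReal.ofReal_mul (by positivity), mul_one_div]

/-- With positive probability, the omitted points avoid given elements of `ℐ` in all late
columns. -/
lemma eventually_unitMeasure_avoid_pos (F : Finset (Set (ℕ × ℕ))) (hF : ↑F ⊆ summableFamily) :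
    ∀ᶠ m in Filter.atTop,
      unitMeasure {t | ∀ W ∈ F, ∀ k, m ≤ k → dyadic k t ∉ sec W k} ≠ 0 := by
  let f : ℕ → ℝ := fun k => ∑ W ∈ F, ((sec W k).ncard : ℝ) / 2 ^ k
  have hf : Summable f := summable_sum fun W hW => (hF hW).2
  have htail := (ENNReal.tendsto_sum_nat_add (fun k => ENNReal.ofReal (f k))
    hf.tsum_ofReal_ne_top).eventually (gt_mem_nhds one_pos)
  filter_upwards [htail] with m hm h0
  refine hm.not_ge ?_
  have hbad : unitMeasure (⋃ k, ⋃ W ∈ F, {t | dyadic (k + m) t ∈ sec W (k + m)}) ≤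
      ∑' k, ENNReal.ofReal (f (k + m)) := by
    refine (measure_iUnion_le _).trans (ENNReal.tsum_le_tsum fun k => ?_)
    refine (measure_biUnion_finset_le _ _).trans ?_
    rw [ENNReal.ofReal_sum_of_nonneg fun W _ => by positivity]
    exact Finset.sum_le_sum fun W hW => unitMeasure_dyadic_mem_le _
      ((finite_Iio _).subset ((hF hW).1 _))
  have hcover : (univ : Set ℝ) ⊆ {t | ∀ W ∈ F, ∀ k, m ≤ k → dyadic k t ∉ sec W k} ∪
      ⋃ k, ⋃ W ∈ F, {t | dyadic (k + m) t ∈ sec W (k + m)} := by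
    intro t _
    by_contra! h
    rw [mem_union, not_or] at h
    refine h.1 fun W hW k hk hmem => h.2 (mem_iUnion.2 ⟨k - m, mem_iUnion₂.2 ⟨W, hW, ?_⟩⟩)
    rwa [mem_ofPred_eq, Nat.sub_add_cancel hk]
  calc (1 : ENNReal) = unitMeasure univ := measure_univ.symm
    _ ≤ _ := (measure_mono hcover).trans (measure_union_le _ _)
    _ ≤ _ := by rw [h0, zero_add]; exact hbad

/-- The law of the pair defining the random branch. -/
noncomputable def branchMeasure : Measure (Omega × ℝ) :=
  ((Measure.count : Measure Omega).prod unitMeasure).toFinite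

lemma count_prod_unitMeasure_ne_zero {p : Omega} {G : Set ℝ} (hG : unitMeasure G ≠ 0) :
    (Measure.count : Measure Omega).prod unitMeasure ({p} ×ˢ G) ≠ 0 := by
  rw [Measure.prod_prod, Measure.count_singleton, one_mul]
  exact hG

/-- Passing to `toFinite` normalises a nonzero s-finite measure without changing its null sets, so
positivity can be tested on the product with counting measure. -/
instance : IsProbabilityMeasure branchMeasure := by
  have : NeZero ((Measure.count : Measure Omega).prod unitMeasure) := ⟨fun h =>
    count_prod_unitMeasure_ne_zero (p := node ∅ empty_mem_slaloms 0) (G := univ)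
      (by rw [measure_univ]; exact one_ne_zero) (by rw [h]; rfl)⟩
  unfold branchMeasure
  infer_instance

/-- A nonzero class has an infinite representative `b`, hence a node `p ∈ b` high enough for both
the finite determination and the avoidance estimate. For each omission pattern avoiding the relevant
`W` from the height of `p` on, the branch extending `p` lies in the clopen set of `b`. -/
lemma branchMeasure_mem_randomBranch_ne_zero {c : slalomAlgebraModFin familyW} (hc : c ≠ ⊥) :
    branchMeasure {x | c ∈ (randomBranch x).carrier} ≠ 0 := by
  obtain ⟨b, rfl⟩ := quotientHom_surjective c
  rw [Ne, quotientHom_eq_bot] at hc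
  obtain ⟨F, hF, N, hdet⟩ := exists_finite_determination b.2
  obtain ⟨M, hM⟩ := Filter.eventually_atTop.1
    (eventually_unitMeasure_avoid_pos F fun W hW => (hF hW).1)
  obtain ⟨p, hpb, hp⟩ : ∃ p ∈ b.1, max N M ≤ p.1.2 := by
    by_contra! h
    exact hc ((finite_levels_below (max N M)).subset fun p hp => (h p hp).le)
  have hNp : N ≤ p.1.2 := le_of_max_le_left hp
  intro h0
  refine count_prod_unitMeasure_ne_zero (p := p) (hM _ (le_of_max_le_right hp))
    (measure_mono_null ?_ (absolutelyContinuous_toFinite _ h0))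
  rintro ⟨q, t⟩ ⟨hq, ht⟩
  obtain rfl : q = p := hq
  have hinter := extendOmitting_inter_box q t
  -- Below the height of `q` the node already covers `W`; above it, `W` avoids the only point
  -- missing from each column.
  have hsub : ∀ W ∈ F, q ∈ TSet W → W ⊆ extendOmitting q t := by
    intro W hW hqW z hz
    have hz2 : z.2 < 2 ^ z.1 := (hF hW).1.1 z.1 hz
    rcases lt_or_ge z.1 q.1.2 with hlt | hge
    · exact .inl (hqW ⟨hz, hlt, lt_of_lt_of_le hz2 (Nat.pow_le_pow_right two_pos hlt.le)⟩)
    · refine .inr ⟨hge, hz2, fun h => ht W hW z.1 hge ?_⟩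
      rw [← h]
      exact hz
  refine quotientHom_mem_branch.2 ((Filter.eventually_ge_atTop q.1.2).mono fun n hn => ?_)
  -- The later nodes of the branch agree with `q` on `box N` and lie in the same `T_W` for `W ∈ F`,
  -- so they inherit membership in `b`.
  refine (hdet q _ hNp (hNp.trans hn) ?_ fun W hW => ?_).1 hpb
  · rw [node, inter_assoc, inter_eq_right.2 (box_mono (hNp.trans hn))]
    nth_rw 1 [← hinter]
    rw [inter_assoc, inter_eq_right.2 (box_mono hNp)]
  · refine ⟨fun h => node_mem_TSet.2 (inter_subset_left.trans (hsub W hW h)), fun h z hz => ?_⟩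
    rw [← hinter]
    exact ⟨node_mem_TSet.1 h ⟨hz.1, box_mono hn hz.2⟩, hz.2⟩

theorem supportsMeasure_KSpace : SupportsMeasure (KSpace familyW) :=
  StoneSpace.supportsMeasure_of_random branchMeasure randomBranch measurableSet_mem_randomBranch
    fun _ hc => branchMeasure_mem_randomBranch_ne_zero hc

end SlalomGrowth

open SlalomGrowth in
theorem mainTheorem2 :
    IsGrowthOfOmega (KSpace familyW) ∧
    ¬ TopologicalSpace.SeparableSpace (KSpace familyW) ∧
    SupportsMeasure (KSpace familyW) ∧
    ∀ ι : Type, #ι = 𝔠 →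
      ∃ f : KSpace familyW → (ι → unitInterval), Continuous f ∧ Function.Surjective f :=
  ⟨isGrowthOfOmega_KSpace, not_separableSpace_KSpace, supportsMeasure_KSpace,
    exists_continuous_surjective_cube⟩
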